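/- Let $\Sigma$ be a compact connected Riemann surface with canonical bundle $K$, let $L=K^{-1/2}$ be a holomorphic line bundle with $L\otimes L\cong K^{-1}$, let $n\ge 1$, and let $(U,\theta)$ be a holomorphic symplectic vector bundle of rank $2n-2$ on $\Sigma$. Let $$0\to L\to E\to U\to 0,\qquad 0\to E\to V\xrightarrow{\ q\ } L^{-1}\to 0$$ be extensions of holomorphic vector bundles, with classes $\delta\in\operatorname{Ext}^1(U,L)\cong H^1(\Sigma,U^*\otimes L)$ and $\widetilde\delta\in\operatorname{Ext}^1(L^{-1},E)\cong H^1(\Sigma,E\otimes L)$; here the class of an extension $0\to A\to F\to B\to 0$ is represented by the Čech cocycle $\sigma_j-\sigma_i$ of differences of local splittings $\sigma_i\colon B\to F$. Let $\theta^\flat\colon U\to U^*$, $u\mapsto\theta(u,\cdot)$, and let the $\theta$-dual $\delta^\theta\in\operatorname{Ext}^1(L^{-1},U)\cong H^1(\Sigma,U\otimes L)$ be the image of $\delta$ under $(\theta^\flat)^{-1}\otimes\operatorname{id}_L\colon U^*\otimes L\to U\otimes L$. Equivalently, if $\delta$ is represented by a cocycle $c_{ij}\colon U\to L$, then $\delta^\theta$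 is represented by the cocycle $c^\theta_{ij}\colon L^{-1}\to U$ with $\theta(c^\theta_{ij}(s),u)=\langle c_{ij}(u),s\rangle$, where $\langle\,,\rangle\colon L\otimes L^{-1}\to\mathcal O_\Sigma$ is the natural pairing. Then $V$ carries a holomorphic symplectic form $\omega$ such that $L^\perp=E$, such that the form induced by $\omega$ on $E/L\cong U$ is $\theta$, and such that the identification $V/E\cong L^{-1}$ given by $q$ is the one induced by $\omega$, that is, $\omega(\ell,v)=\langle\ell,q(v)\rangle$ for all $\ell\in L$ and $v\in V$, if and only if the image of $\widetilde\delta$ under $\operatorname{Ext}^1(L^{-1},E)\to\operatorname{Ext}^1(L^{-1},U)$ is $\delta^\theta$. -/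

import Mathlib

open Bundle Set
open scoped Manifold ContDiff Topology

universe u v w w₁ w₂

/-- A holomorphic vector bundle of finite rank over `X`: an analytic (`ω`) vector bundle in the
sense of Mathlib, over the complex numbers, bundled with its model fibre. -/
structure HolBundle (X : Type u) [TopologicalSpace X] [ChartedSpace ℂ X] where
  Model : Type v
  Fiber : X → Type v
  [normed : NormedAddCommGroup Model]
  [normedSpace : NormedSpace ℂ Model]
  [finiteDim : FiniteDimensional ℂ Model]
  [addCommGroup : ∀ x, AddCommGroup (Fiber x)]
  [module : ∀ x, Module ℂ (Fiber x)]
  [topFiber : ∀ x, TopologicalSpace (Fiber x)]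
  [topAddGroup : ∀ x, IsTopologicalAddGroup (Fiber x)]
  [contSMul : ∀ x, ContinuousSMul ℂ (Fiber x)]
  [topTotal : TopologicalSpace (TotalSpace Model Fiber)]
  [fiberBundle : FiberBundle Model Fiber]
  [vectorBundle : VectorBundle ℂ Model Fiber]
  [holomorphic : ContMDiffVectorBundle ω Model Fiber 𝓘(ℂ)]

namespace HolBundle

attribute [instance] normed normedSpace finiteDim addCommGroup module topFiber topAddGroup contSMul
  topTotal fiberBundle vectorBundle holomorphic

noncomputable section Basic

variable {X : Type u} [TopologicalSpace X] [ChartedSpace ℂ X]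

/-- The rank of a vector bundle. -/
def rank (A : HolBundle.{u, v} X) : ℕ := Module.finrank ℂ A.Model

/-- The bundle `Hom(A, B)`. -/
abbrev hom (A : HolBundle.{u, v} X) (B : HolBundle.{u, w} X) :
    HolBundle.{u, max v w} X where
  Model := A.Model →L[ℂ] B.Model
  Fiber x := A.Fiber x →L[ℂ] B.Fiber x

/-- The dual bundle `A* = Hom(A, 𝒪)`; for a line bundle this is `A⁻¹`. -/
abbrev dual (A : HolBundle.{u, v} X) : HolBundle.{u, v} X where
  Model := A.Model →L[ℂ] ℂ
  Fiber x := A.Fiber x →L[ℂ] ℂ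
  topTotal := Bundle.ContinuousLinearMap.topologicalSpaceTotalSpace
    (RingHom.id ℂ) A.Model A.Fiber ℂ (Bundle.Trivial X ℂ)
  fiberBundle := Bundle.ContinuousLinearMap.fiberBundle
    (RingHom.id ℂ) A.Model A.Fiber ℂ (Bundle.Trivial X ℂ)
  vectorBundle := Bundle.ContinuousLinearMap.vectorBundle
    (RingHom.id ℂ) A.Model A.Fiber ℂ (Bundle.Trivial X ℂ)
  holomorphic := ContMDiffVectorBundle.continuousLinearMap (E₂ := Bundle.Trivial X ℂ)

/-- The holomorphic tangent bundle; on a Riemann surface it is `K⁻¹`. -/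
abbrev tangent (X : Type u) [TopologicalSpace X] [ChartedSpace ℂ X]
    [IsManifold 𝓘(ℂ) ω X] : HolBundle.{u, 0} X where
  Model := ℂ
  Fiber x := TangentSpace 𝓘(ℂ) x

variable {A : HolBundle.{u, v} X} {B : HolBundle.{u, w} X} {C : HolBundle.{u, w₁} X}

/-- The family of fibre maps `φ x : A x → B x` is holomorphic on `W`: it is a holomorphic section
of the bundle `Hom(A, B)` there. -/
def IsHolOn (W : Set X) (φ : ∀ x, A.Fiber x →L[ℂ] B.Fiber x) : Prop :=
  ContMDiffOn 𝓘(ℂ) (𝓘(ℂ).prod 𝓘(ℂ, A.Model →L[ℂ] B.Model)) ω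
    (fun x => TotalSpace.mk' (A.Model →L[ℂ] B.Model)
      (E := fun x => A.Fiber x →L[ℂ] B.Fiber x) x (φ x)) W

/-- The matrix of a family of fibre maps, in the preferred trivialisations at `x₀`. -/
def coord (φ : ∀ x, A.Fiber x →L[ℂ] B.Fiber x) (x₀ x : X) :
    A.Model →L[ℂ] B.Model :=
  ContinuousLinearMap.inCoordinates A.Model A.Fiber B.Model B.Fiber x₀ x x₀ x (φ x)

/-- The domain of the preferred trivialisation at `x₀`. -/
def triv (A : HolBundle.{u, v} X) (x₀ : X) : Set X :=
  (trivializationAt A.Model A.Fiber x₀).baseSet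

theorem triv_mem (A : HolBundle.{u, v} X) (x₀ : X) : A.triv x₀ ∈ 𝓝 x₀ :=
  (trivializationAt A.Model A.Fiber x₀).open_baseSet.mem_nhds
    (FiberBundle.mem_baseSet_trivializationAt' x₀)

/-- The preferred trivialisation at `x₀`, on the fibre at `x`. -/
def chart (A : HolBundle.{u, v} X) (x₀ : X) {x : X} (hx : x ∈ A.triv x₀) :
    A.Fiber x ≃L[ℂ] A.Model :=
  (trivializationAt A.Model A.Fiber x₀).continuousLinearEquivAt ℂ x hx

theorem coord_eq (φ : ∀ x, A.Fiber x →L[ℂ] B.Fiber x) {x₀ x : X} (hA : x ∈ A.triv x₀)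
    (hB : x ∈ B.triv x₀) :
    coord φ x₀ x = (B.chart x₀ hB : B.Fiber x →L[ℂ] B.Model) ∘L φ x ∘L
      ((A.chart x₀ hA).symm : A.Model →L[ℂ] A.Fiber x) :=
  ContinuousLinearMap.inCoordinates_eq hA hB

theorem isHolOn_iff {W : Set X} (φ : ∀ x, A.Fiber x →L[ℂ] B.Fiber x) :
    IsHolOn W φ ↔ ∀ x₀ ∈ W, ContMDiffWithinAt 𝓘(ℂ) 𝓘(ℂ, A.Model →L[ℂ] B.Model) ω
      (coord φ x₀) W x₀ := by
  refine forall₂_congr fun x₀ _ => ?_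
  rw [contMDiffWithinAt_hom_bundle]
  exact and_iff_right contMDiffWithinAt_id

theorem IsHolOn.mono {W W' : Set X} {φ : ∀ x, A.Fiber x →L[ℂ] B.Fiber x} (h : IsHolOn W φ)
    (hW : W' ⊆ W) : IsHolOn W' φ :=
  ContMDiffOn.mono h hW

theorem IsHolOn.congr {W : Set X} {φ ψ : ∀ x, A.Fiber x →L[ℂ] B.Fiber x} (h : IsHolOn W φ)
    (hW : ∀ x ∈ W, ψ x = φ x) : IsHolOn W ψ :=
  ContMDiffOn.congr h fun x hx => by rw [hW x hx]

theorem IsHolOn.add {W : Set X} {φ ψ : ∀ x, A.Fiber x →L[ℂ] B.Fiber x} (h : IsHolOn W φ)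
    (h' : IsHolOn W ψ) : IsHolOn W (fun x => φ x + ψ x) :=
  ContMDiffOn.add_section (V := fun x => A.Fiber x →L[ℂ] B.Fiber x) h h'

theorem IsHolOn.smul {W : Set X} {φ : ∀ x, A.Fiber x →L[ℂ] B.Fiber x} (c : ℂ) (h : IsHolOn W φ) :
    IsHolOn W (fun x => c • φ x) :=
  ContMDiffOn.const_smul_section (V := fun x => A.Fiber x →L[ℂ] B.Fiber x) h

theorem isHolOn_zero (W : Set X) : IsHolOn W (fun x => (0 : A.Fiber x →L[ℂ] B.Fiber x)) := by
  rw [isHolOn_iff]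
  intro x₀ _
  have : coord (fun x => (0 : A.Fiber x →L[ℂ] B.Fiber x)) x₀ = fun _ => 0 := by
    ext x m; simp [coord, ContinuousLinearMap.inCoordinates]
  rw [this]
  exact contMDiffWithinAt_const

/-- A criterion by germs of coordinate matrices. -/
theorem IsHolOn.of_coord {W : Set X} {φ : ∀ x, A.Fiber x →L[ℂ] B.Fiber x}
    (h : ∀ x₀ ∈ W, ∃ f : X → A.Model →L[ℂ] B.Model,
      ContMDiffWithinAt 𝓘(ℂ) 𝓘(ℂ, A.Model →L[ℂ] B.Model) ω f W x₀ ∧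
      ∀ x (_ : x ∈ W) (hA : x ∈ A.triv x₀) (hB : x ∈ B.triv x₀),
        f x = (B.chart x₀ hB : B.Fiber x →L[ℂ] B.Model) ∘L φ x ∘L
      ((A.chart x₀ hA).symm : A.Model →L[ℂ] A.Fiber x)) : IsHolOn W φ := by
  rw [isHolOn_iff]
  intro x₀ hx₀
  obtain ⟨f, hf, hfe⟩ := h x₀ hx₀
  refine hf.congr_of_eventuallyEq_of_mem ?_ hx₀
  filter_upwards [nhdsWithin_le_nhds (A.triv_mem x₀), nhdsWithin_le_nhds (B.triv_mem x₀),
    self_mem_nhdsWithin] with x hA hB hx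
  rw [coord_eq φ hA hB, hfe x hx hA hB]

theorem IsHolOn.comp {W : Set X} {φ : ∀ x, A.Fiber x →L[ℂ] B.Fiber x}
    {ψ : ∀ x, B.Fiber x →L[ℂ] C.Fiber x} (hψ : IsHolOn W ψ) (hφ : IsHolOn W φ) :
    IsHolOn W (fun x => ψ x ∘L φ x) := by
  rw [isHolOn_iff] at hψ hφ ⊢
  intro x₀ hx₀
  refine ((hψ x₀ hx₀).clm_comp (hφ x₀ hx₀)).congr_of_eventuallyEq_of_mem ?_ hx₀
  filter_upwards [nhdsWithin_le_nhds (A.triv_mem x₀), nhdsWithin_le_nhds (B.triv_mem x₀),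
    nhdsWithin_le_nhds (C.triv_mem x₀)] with x hA hB hC
  rw [coord_eq _ hA hB, coord_eq _ hB hC, coord_eq _ hA hC]
  ext m
  simp

theorem isHolOn_id (W : Set X) : IsHolOn W (fun x => ContinuousLinearMap.id ℂ (A.Fiber x)) :=
  IsHolOn.of_coord fun x₀ _ => ⟨fun _ => ContinuousLinearMap.id ℂ A.Model,
    contMDiffWithinAt_const, fun x _ hA hB => by ext m; simp⟩

/-- Transposition of a holomorphic family of fibre maps. -/
theorem dual_triv (A : HolBundle.{u, v} X) {x₀ x : X} (hx : x ∈ A.dual.triv x₀) : x ∈ A.triv x₀ :=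
  hx.1

theorem dual_chart_apply (A : HolBundle.{u, v} X) {x₀ x : X} (hx : x ∈ A.dual.triv x₀)
    (s : A.dual.Fiber x) :
    (A.dual.chart x₀ hx s : A.Model →L[ℂ] ℂ) =
      s ∘L ((A.chart x₀ (A.dual_triv hx)).symm : A.Model →L[ℂ] A.Fiber x) := by
  have h1 : (A.dual.chart x₀ hx s : A.Model →L[ℂ] ℂ) =
      ContinuousLinearMap.inCoordinates A.Model A.Fiber ℂ (Bundle.Trivial X ℂ) x₀ x x₀ x s := rfl
  rw [h1, ContinuousLinearMap.inCoordinates_eq (A.dual_triv hx) (mem_univ x)]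
  ext m
  rfl

theorem IsHolOn.transpose {W : Set X} {φ : ∀ x, A.Fiber x →L[ℂ] B.Fiber x} (hφ : IsHolOn W φ) :
    IsHolOn (A := B.dual) (B := A.dual) W
      (fun x => (ContinuousLinearMap.precomp ℂ (φ x) : _ →L[ℂ] _)) := by
  refine IsHolOn.of_coord fun x₀ hx₀ =>
    ⟨fun x => (ContinuousLinearMap.compL ℂ A.Model B.Model ℂ).flip (coord φ x₀ x), ?_, ?_⟩
  · exact (ContinuousLinearMap.contMDiff _).contMDiffAt.comp_contMDiffWithinAt x₀
      ((isHolOn_iff φ).1 hφ x₀ hx₀)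
  · intro x _ hB hA
    ext s : 1
    obtain ⟨t, rfl⟩ := (B.dual.chart x₀ hB).surjective s
    simp only [ContinuousLinearMap.comp_apply, ContinuousLinearEquiv.coe_coe,
      ContinuousLinearEquiv.symm_apply_apply]
    rw [dual_chart_apply, dual_chart_apply, coord_eq φ (A.dual_triv hA) (B.dual_triv hB)]
    ext m
    simp

theorem IsHolOn.inverse {W : Set X} {φ : ∀ x, A.Fiber x →L[ℂ] B.Fiber x} (hφ : IsHolOn W φ)
    (hi : ∀ x ∈ W, (φ x).IsInvertible) : IsHolOn W (fun x => (φ x).inverse) := by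
  rw [isHolOn_iff] at hφ ⊢
  intro x₀ hx₀
  have h1 := hφ x₀ hx₀
  have hinv : (coord φ x₀ x₀).IsInvertible := by
    rw [coord_eq φ (mem_of_mem_nhds (A.triv_mem x₀)) (mem_of_mem_nhds (B.triv_mem x₀))]
    exact ContinuousLinearMap.isInvertible_equiv.comp
      ((hi x₀ hx₀).comp ContinuousLinearMap.isInvertible_equiv)
  have h2 := (hinv.contDiffAt_map_inverse (n := ω)).contMDiffAt.comp_contMDiffWithinAt x₀ h1
  refine h2.congr_of_eventuallyEq_of_mem ?_ hx₀
  filter_upwards [nhdsWithin_le_nhds (A.triv_mem x₀), nhdsWithin_le_nhds (B.triv_mem x₀)]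
    with x hA hB
  rw [Function.comp_apply, coord_eq _ hA hB, coord_eq _ hB hA]
  simp only [ContinuousLinearMap.inverse_equiv_comp, ContinuousLinearMap.inverse_comp_equiv,
    ContinuousLinearEquiv.symm_symm]
  rfl

/-- A family of fibre maps extends from a point. -/
theorem exists_local_extension (x₀ : X) (T : A.Fiber x₀ →L[ℂ] B.Fiber x₀) :
    ∃ φ : ∀ x, A.Fiber x →L[ℂ] B.Fiber x, ∃ W : Set X, IsOpen W ∧ x₀ ∈ W ∧ IsHolOn W φ ∧
      φ x₀ = T := by
  classical
  have hA₀ := mem_of_mem_nhds (A.triv_mem x₀)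
  have hB₀ := mem_of_mem_nhds (B.triv_mem x₀)
  let T' : A.Model →L[ℂ] B.Model := (B.chart x₀ hB₀ : B.Fiber x₀ →L[ℂ] B.Model) ∘L T ∘L
      ((A.chart x₀ hA₀).symm : A.Model →L[ℂ] A.Fiber x₀)
  let φ : ∀ x, A.Fiber x →L[ℂ] B.Fiber x := fun x =>
    if h : x ∈ A.triv x₀ ∧ x ∈ B.triv x₀ then
      ((B.chart x₀ h.2).symm : B.Model →L[ℂ] B.Fiber x) ∘L T' ∘L
        (A.chart x₀ h.1 : A.Fiber x →L[ℂ] A.Model) else 0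
  have hc : ∀ x (hA : x ∈ A.triv x₀) (hB : x ∈ B.triv x₀), φ x =
      ((B.chart x₀ hB).symm : B.Model →L[ℂ] B.Fiber x) ∘L T' ∘L
        (A.chart x₀ hA : A.Fiber x →L[ℂ] A.Model) := fun x hA hB => dif_pos ⟨hA, hB⟩
  refine ⟨φ, A.triv x₀ ∩ B.triv x₀, ?_, ⟨hA₀, hB₀⟩, ?_, ?_⟩
  · exact (trivializationAt A.Model A.Fiber x₀).open_baseSet.inter
      (trivializationAt B.Model B.Fiber x₀).open_baseSet
  · intro x hx
    refine ((Trivialization.contMDiffAt_section_iff (IB := 𝓘(ℂ)) (n := ω)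
      (F := A.Model →L[ℂ] B.Model) (E := fun x => A.Fiber x →L[ℂ] B.Fiber x)
      (trivializationAt (A.Model →L[ℂ] B.Model) (fun x => A.Fiber x →L[ℂ] B.Fiber x) x₀)
      (x₀ := x) hx).2 ?_).contMDiffWithinAt
    refine (contMDiffAt_const (c := T')).congr_of_eventuallyEq ?_
    have ho : A.triv x₀ ∩ B.triv x₀ ∈ 𝓝 x :=
      ((trivializationAt A.Model A.Fiber x₀).open_baseSet.inter
      (trivializationAt B.Model B.Fiber x₀).open_baseSet).mem_nhds hx
    filter_upwards [ho] with y hy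
    change coord φ x₀ y = T'
    rw [coord_eq φ hy.1 hy.2, hc y hy.1 hy.2]
    ext m
    simp
  · rw [hc x₀ hA₀ hB₀]
    ext m
    simp [T']

theorem IsHolOn.eventually_invertible {W : Set X} (hW : IsOpen W)
    {φ : ∀ x, A.Fiber x →L[ℂ] B.Fiber x} (hφ : IsHolOn W φ) {x₀ : X} (hx₀ : x₀ ∈ W)
    (hi : (φ x₀).IsInvertible) : ∀ᶠ x in 𝓝 x₀, (φ x).IsInvertible := by
  have h1 := ((isHolOn_iff φ).1 hφ x₀ hx₀).continuousWithinAt.continuousAt (hW.mem_nhds hx₀)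
  obtain ⟨e, he⟩ : (coord φ x₀ x₀).IsInvertible := by
    rw [coord_eq φ (mem_of_mem_nhds (A.triv_mem x₀)) (mem_of_mem_nhds (B.triv_mem x₀))]
    exact ContinuousLinearMap.isInvertible_equiv.comp
      (hi.comp ContinuousLinearMap.isInvertible_equiv)
  have h2 := h1 (he ▸ ContinuousLinearEquiv.nhds e)
  filter_upwards [h2, A.triv_mem x₀, B.triv_mem x₀] with x hx hA hB
  obtain ⟨e', he'⟩ := hx
  rw [coord_eq φ hA hB] at he'
  refine ⟨((A.chart x₀ hA).trans e').trans (B.chart x₀ hB).symm, ?_⟩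
  ext m
  have := DFunLike.congr_fun he' (A.chart x₀ hA m)
  simp only [ContinuousLinearMap.comp_apply, ContinuousLinearEquiv.coe_coe,
    ContinuousLinearEquiv.symm_apply_apply] at this
  simp [this]

theorem IsHolOn.of_local {W : Set X} {φ : ∀ x, A.Fiber x →L[ℂ] B.Fiber x}
    (h : ∀ x ∈ W, ∃ W' : Set X, IsOpen W' ∧ x ∈ W' ∧ IsHolOn (W ∩ W') φ) : IsHolOn W φ :=
  contMDiffOn_of_locally_contMDiffOn h

instance (A : HolBundle.{u, v} X) (x : X) : T2Space (A.Fiber x) :=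
  (A.chart x (mem_of_mem_nhds (A.triv_mem x))).toHomeomorph.symm.t2Space

instance (A : HolBundle.{u, v} X) (x : X) : FiniteDimensional ℂ (A.Fiber x) :=
  (A.chart x (mem_of_mem_nhds (A.triv_mem x))).symm.toLinearEquiv.finiteDimensional

theorem isInvertible_of_bijective {x : X} {f : A.Fiber x →L[ℂ] B.Fiber x}
    (hf : Function.Bijective f) : f.IsInvertible :=
  ⟨(LinearEquiv.ofBijective (f : A.Fiber x →ₗ[ℂ] B.Fiber x) hf).toContinuousLinearEquiv, by
    ext; rfl⟩

end Basic

noncomputable section Hom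

variable {X : Type u} [TopologicalSpace X] [ChartedSpace ℂ X]

/-- A morphism of holomorphic vector bundles. -/
structure Morphism (A : HolBundle.{u, v} X) (B : HolBundle.{u, w} X) where
  toFun : ∀ x, A.Fiber x →L[ℂ] B.Fiber x
  isHol : IsHolOn univ toFun

instance (A : HolBundle.{u, v} X) (B : HolBundle.{u, w} X) :
    CoeFun (Morphism A B) (fun _ => ∀ x, A.Fiber x →L[ℂ] B.Fiber x) := ⟨Morphism.toFun⟩

variable {A : HolBundle.{u, v} X} {B : HolBundle.{u, w} X} {C : HolBundle.{u, w₁} X}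

theorem Morphism.exists_local_section (p : Morphism A B) (hp : ∀ x, Function.Surjective (p x))
    (x₀ : X) : ∃ (W : Set X) (s : ∀ x, B.Fiber x →L[ℂ] A.Fiber x), IsOpen W ∧ x₀ ∈ W ∧
      IsHolOn W s ∧ ∀ x ∈ W, p x ∘L s x = ContinuousLinearMap.id ℂ _ := by
  obtain ⟨g, hg⟩ := LinearMap.exists_rightInverse_of_surjective (p x₀ : A.Fiber x₀ →ₗ[ℂ] B.Fiber x₀)
    (LinearMap.range_eq_top.2 (hp x₀))
  obtain ⟨t, W, hW, hxW, ht, htx⟩ := exists_local_extension x₀ (LinearMap.toContinuousLinearMap g)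
  have hpt : IsHolOn W (fun x => p x ∘L t x) := (p.isHol.mono (subset_univ _)).comp ht
  have hi : (p x₀ ∘L t x₀).IsInvertible := by
    refine ⟨ContinuousLinearEquiv.refl ℂ _, ?_⟩
    ext m
    rw [htx]
    exact (LinearMap.congr_fun hg m).symm
  obtain ⟨W', hW's, hW', hxW'⟩ := mem_nhds_iff.1 (hpt.eventually_invertible hW hxW hi)
  refine ⟨W ∩ W', fun x => t x ∘L (p x ∘L t x).inverse, hW.inter hW', ⟨hxW, hxW'⟩, ?_, ?_⟩
  · exact (ht.mono inter_subset_left).comp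
      ((hpt.mono inter_subset_left).inverse fun x hx => hW's hx.2)
  · intro x hx
    rw [← ContinuousLinearMap.comp_assoc]
    exact (hW's hx.2 : (p x ∘L t x).IsInvertible).self_comp_inverse

theorem Morphism.exists_local_retraction (i : Morphism A B) (hp : ∀ x, Function.Injective (i x))
    (x₀ : X) : ∃ (W : Set X) (r : ∀ x, B.Fiber x →L[ℂ] A.Fiber x), IsOpen W ∧ x₀ ∈ W ∧
      IsHolOn W r ∧ ∀ x ∈ W, r x ∘L i x = ContinuousLinearMap.id ℂ _ := by
  obtain ⟨g, hg⟩ := LinearMap.exists_leftInverse_of_injective (i x₀ : A.Fiber x₀ →ₗ[ℂ] B.Fiber x₀)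
    (LinearMap.ker_eq_bot.2 (hp x₀))
  obtain ⟨t, W, hW, hxW, ht, htx⟩ := exists_local_extension x₀ (LinearMap.toContinuousLinearMap g)
  have hpt : IsHolOn W (fun x => t x ∘L i x) := ht.comp (i.isHol.mono (subset_univ _))
  have hi : (t x₀ ∘L i x₀).IsInvertible := by
    refine ⟨ContinuousLinearEquiv.refl ℂ _, ?_⟩
    ext m
    rw [htx]
    exact (LinearMap.congr_fun hg m).symm
  obtain ⟨W', hW's, hW', hxW'⟩ := mem_nhds_iff.1 (hpt.eventually_invertible hW hxW hi)
  refine ⟨W ∩ W', fun x => (t x ∘L i x).inverse ∘L t x, hW.inter hW', ⟨hxW, hxW'⟩, ?_, ?_⟩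
  · exact ((hpt.mono inter_subset_left).inverse fun x hx => hW's hx.2).comp
      (ht.mono inter_subset_left)
  · intro x hx
    rw [ContinuousLinearMap.comp_assoc]
    exact (hW's hx.2 : (t x ∘L i x).IsInvertible).inverse_comp_self

/-- Division by an injective bundle map. -/
theorem Morphism.exists_factor (i : Morphism A B) (hi : ∀ x, Function.Injective (i x)) {W : Set X}
    {d : ∀ x, C.Fiber x →L[ℂ] B.Fiber x} (hd : IsHolOn W d)
    (hr : ∀ x ∈ W, ∀ m, d x m ∈ range (i x)) :
    ∃ c : ∀ x, C.Fiber x →L[ℂ] A.Fiber x, IsHolOn W c ∧ ∀ x ∈ W, i x ∘L c x = d x := by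
  choose g hg using fun x => LinearMap.exists_leftInverse_of_injective (i x : A.Fiber x →ₗ[ℂ] B.Fiber x)
    (LinearMap.ker_eq_bot.2 (hi x))
  have hc : ∀ x ∈ W, i x ∘L (LinearMap.toContinuousLinearMap (g x) ∘L d x) = d x := by
    intro x hx
    ext m
    obtain ⟨a, ha⟩ := hr x hx m
    have := LinearMap.congr_fun (hg x) a
    simp only [LinearMap.comp_apply, ContinuousLinearMap.coe_coe, LinearMap.id_apply] at this
    simp [← ha, this]
  refine ⟨fun x => LinearMap.toContinuousLinearMap (g x) ∘L d x, ?_, hc⟩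
  refine IsHolOn.of_local fun x₀ hx₀ => ?_
  obtain ⟨W', r, hW', hxW', hr', hri⟩ := i.exists_local_retraction hi x₀
  refine ⟨W', hW', hxW', ?_⟩
  refine ((hr'.mono inter_subset_right).comp (hd.mono inter_subset_left)).congr fun x hx => ?_
  have h := congrArg (fun f => r x ∘L f) (hc x hx.1)
  rw [← ContinuousLinearMap.comp_assoc, hri x hx.2, ContinuousLinearMap.id_comp] at h
  exact h

/-- The holomorphic bundle maps `A → B` over `W`, as a subspace of all families of linear maps of
the fibres over `W`. (The family `ψ` is arbitrary outside `W`.) -/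
def homOn (A : HolBundle.{u, v} X) (B : HolBundle.{u, w} X) (W : Set X) :
    Submodule ℂ (∀ x : W, A.Fiber x →L[ℂ] B.Fiber x) where
  carrier := {φ | ∃ ψ : ∀ x, A.Fiber x →L[ℂ] B.Fiber x, IsHolOn W ψ ∧ ∀ x : W, φ x = ψ x}
  zero_mem' := ⟨fun _ => 0, isHolOn_zero W, fun _ => rfl⟩
  add_mem' := by
    rintro φ φ' ⟨ψ, h, e⟩ ⟨ψ', h', e'⟩
    exact ⟨_, h.add h', fun x => by rw [Pi.add_apply, e, e']⟩
  smul_mem' := by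
    rintro c φ ⟨ψ, h, e⟩
    exact ⟨_, h.smul c, fun x => by rw [Pi.smul_apply, e]⟩

/-- `ℋom(A, B)(W)`, the sections over `W` of the sheaf of holomorphic bundle maps `A → B`. -/
def Sec (A : HolBundle.{u, v} X) (B : HolBundle.{u, w} X) (W : Set X) : Type (max u v w) :=
  homOn A B W

instance (A : HolBundle.{u, v} X) (B : HolBundle.{u, w} X) (W : Set X) :
    AddCommGroup (Sec A B W) :=
  inferInstanceAs (AddCommGroup (homOn A B W))

instance (A : HolBundle.{u, v} X) (B : HolBundle.{u, w} X) (W : Set X) : Module ℂ (Sec A B W) :=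
  inferInstanceAs (Module ℂ (homOn A B W))

/-- The value at a point of `W`. -/
def Sec.val {A : HolBundle.{u, v} X} {B : HolBundle.{u, w} X} {W : Set X} (φ : Sec A B W)
    (x : X) (hx : x ∈ W) : A.Fiber x →L[ℂ] B.Fiber x :=
  φ.1 ⟨x, hx⟩

@[ext]
theorem Sec.ext {A : HolBundle.{u, v} X} {B : HolBundle.{u, w} X} {W : Set X} {φ ψ : Sec A B W}
    (h : ∀ x hx, φ.val x hx = ψ.val x hx) : φ = ψ :=
  Subtype.ext (funext fun x => h x.1 x.2)

/-- Restriction of sections. -/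
def Sec.res (A : HolBundle.{u, v} X) (B : HolBundle.{u, w} X) {W W' : Set X} (h : W' ⊆ W) :
    Sec A B W →ₗ[ℂ] Sec A B W' where
  toFun φ := ⟨fun x => φ.1 ⟨x, h x.2⟩, by
    obtain ⟨ψ, hψ, e⟩ := φ.2
    exact ⟨ψ, hψ.mono h, fun x => e _⟩⟩
  map_add' _ _ := rfl
  map_smul' _ _ := rfl

/-- A fibrewise linear map of sheaves of bundle maps `ℋom(A, B) → ℋom(A', B')`. -/
structure HomMap (A : HolBundle.{u, v} X) (B : HolBundle.{u, w} X)
    (A' : HolBundle.{u, w₁} X) (B' : HolBundle.{u, w₂} X) where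
  toFun : ∀ x, (A.Fiber x →L[ℂ] B.Fiber x) →ₗ[ℂ] (A'.Fiber x →L[ℂ] B'.Fiber x)
  isHol : ∀ (W : Set X) (φ : ∀ x, A.Fiber x →L[ℂ] B.Fiber x), IsHolOn W φ →
    IsHolOn W (fun x => toFun x (φ x))

/-- The map `ℋom(A, B) → ℋom(A, C)`, `φ ↦ f ∘ φ`. -/
def HomMap.postcomp (A : HolBundle.{u, v} X) (f : Morphism B C) : HomMap A B A C where
  toFun x :=
    { toFun := fun φ => f x ∘L φ
      map_add' := fun _ _ => ContinuousLinearMap.comp_add _ _ _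
      map_smul' := fun _ _ => ContinuousLinearMap.comp_smul _ _ _ }
  isHol W _ h := (f.isHol.mono (subset_univ W)).comp h

/-- The transposition `ℋom(A, B) → ℋom(B*, A*)`, `φ ↦ (s ↦ s ∘ φ)`. -/
def HomMap.transpose (A : HolBundle.{u, v} X) (B : HolBundle.{u, w} X) :
    HomMap A B B.dual A.dual where
  toFun x :=
    { toFun := fun φ => ContinuousLinearMap.precomp ℂ φ
      map_add' := fun _ _ => by ext; simp
      map_smul' := fun _ _ => by ext; simp }
  isHol _ _ h := h.transpose

/-- The map `ℋom(A, B)(W) → ℋom(A', B')(W)` on sections. -/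
def HomMap.onSections {A : HolBundle.{u, v} X} {B : HolBundle.{u, w} X}
    {A' : HolBundle.{u, w₁} X} {B' : HolBundle.{u, w₂} X} (T : HomMap A B A' B') (W : Set X) :
    Sec A B W →ₗ[ℂ] Sec A' B' W where
  toFun φ := ⟨fun x => T.toFun x (φ.1 x), by
    obtain ⟨ψ, hψ, e⟩ := φ.2
    exact ⟨_, T.isHol W ψ hψ, fun x => congrArg _ (e x)⟩⟩
  map_add' _ _ := by ext1 x _; exact map_add (T.toFun x) _ _
  map_smul' _ _ := by ext1 x _; exact map_smul (T.toFun x) _ _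

end Hom

/-- An open cover of `X` indexed by the points of `X`, the set with index `a` containing `a`. -/
structure PointedCover (X : Type u) [TopologicalSpace X] where
  nhd : X → Set X
  isOpen : ∀ a, IsOpen (nhd a)
  mem : ∀ a, a ∈ nhd a

/-- `U ≤ V` if `V` refines `U`, index by index. Every open cover is refined by a pointed one, and
any two pointed covers have a common refinement, so that colimits over all open covers can be
computed with pointed ones. -/
instance (X : Type u) [TopologicalSpace X] : Preorder (PointedCover X) where
  le U V := ∀ a, V.nhd a ⊆ U.nhd a
  le_refl _ _ := subset_rfl
  le_trans _ _ _ h h' a := (h' a).trans (h a)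

noncomputable section Cech

variable {X : Type u} [TopologicalSpace X] [ChartedSpace ℂ X]

/-- Čech 0-cochains of `ℋom(A, B)`. -/
abbrev C0 (A : HolBundle.{u, v} X) (B : HolBundle.{u, w} X) (U : PointedCover X) :=
  ∀ a : X, Sec A B (U.nhd a)

/-- Čech 1-cochains of `ℋom(A, B)`. -/
abbrev C1 (A : HolBundle.{u, v} X) (B : HolBundle.{u, w} X) (U : PointedCover X) :=
  ∀ a b : X, Sec A B (U.nhd a ∩ U.nhd b)

/-- The coboundary of a 0-cochain, `(dh)_{ab} = h_b - h_a`. -/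
def d0 (A : HolBundle.{u, v} X) (B : HolBundle.{u, w} X) (U : PointedCover X) :
    C0 A B U →ₗ[ℂ] C1 A B U where
  toFun h a b := Sec.res A B inter_subset_right (h b) - Sec.res A B inter_subset_left (h a)
  map_add' h h' := by
    funext a b; simp only [Pi.add_apply, map_add]; abel
  map_smul' c h := by
    funext a b; simp only [Pi.smul_apply, map_smul, smul_sub, RingHom.id_apply]

/-- The 1-cocycles: `c_{ad} = c_{ab} + c_{bd}` on triple intersections. -/
def Z1 (A : HolBundle.{u, v} X) (B : HolBundle.{u, w} X) (U : PointedCover X) :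
    Submodule ℂ (C1 A B U) where
  carrier := {c | ∀ (a b d x : X) (ha : x ∈ U.nhd a) (hb : x ∈ U.nhd b) (hd : x ∈ U.nhd d),
    (c a d).val x ⟨ha, hd⟩ = (c a b).val x ⟨ha, hb⟩ + (c b d).val x ⟨hb, hd⟩}
  zero_mem' _ _ _ _ _ _ _ := (add_zero _).symm
  add_mem' {c c'} h h' a b d x ha hb hd := by
    change (c a d).val x _ + (c' a d).val x _ =
      ((c a b).val x _ + (c' a b).val x _) + ((c b d).val x _ + (c' b d).val x _)
    rw [h a b d x ha hb hd, h' a b d x ha hb hd]; abel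
  smul_mem' r c h a b d x ha hb hd := by
    change r • (c a d).val x _ = r • (c a b).val x _ + r • (c b d).val x _
    rw [h a b d x ha hb hd, smul_add]

/-- Čech cohomology `H¹(U, ℋom(A, B))` of the cover `U`: 1-cocycles modulo 1-coboundaries. -/
def H1 (A : HolBundle.{u, v} X) (B : HolBundle.{u, w} X) (U : PointedCover X) :
    Type (max u v w) :=
  Z1 A B U ⧸ (LinearMap.range (d0 A B U)).comap (Z1 A B U).subtype

instance (A : HolBundle.{u, v} X) (B : HolBundle.{u, w} X) (U : PointedCover X) :
    AddCommGroup (H1 A B U) :=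
  inferInstanceAs (AddCommGroup (Z1 A B U ⧸ (LinearMap.range (d0 A B U)).comap (Z1 A B U).subtype))

instance (A : HolBundle.{u, v} X) (B : HolBundle.{u, w} X) (U : PointedCover X) :
    Module ℂ (H1 A B U) :=
  inferInstanceAs (Module ℂ (Z1 A B U ⧸ (LinearMap.range (d0 A B U)).comap (Z1 A B U).subtype))

/-- The class of a cocycle. -/
def H1.mk (A : HolBundle.{u, v} X) (B : HolBundle.{u, w} X) (U : PointedCover X) :
    Z1 A B U →ₗ[ℂ] H1 A B U :=
  Submodule.mkQ _

/-- Restriction of cocycles to a refinement. -/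
def Z1.res (A : HolBundle.{u, v} X) (B : HolBundle.{u, w} X) {U V : PointedCover X} (h : U ≤ V) :
    Z1 A B U →ₗ[ℂ] Z1 A B V where
  toFun c := ⟨fun a b => Sec.res A B (inter_subset_inter (h a) (h b)) (c.1 a b),
    fun a b d x ha hb hd => c.2 a b d x (h a ha) (h b hb) (h d hd)⟩
  map_add' _ _ := rfl
  map_smul' _ _ := rfl

/-- Restriction of classes to a refinement. -/
def H1.res (A : HolBundle.{u, v} X) (B : HolBundle.{u, w} X) {U V : PointedCover X} (h : U ≤ V) :
    H1 A B U →ₗ[ℂ] H1 A B V :=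
  Submodule.mapQ _ _ (Z1.res A B h) (by
    rintro c ⟨k, hk⟩
    exact ⟨fun a => Sec.res A B (h a) (k a), by
      funext a b
      have hk' : c.1 a b = d0 A B U k a b := (congrFun (congrFun hk a) b).symm
      change _ = Sec.res A B (inter_subset_inter (h a) (h b)) (c.1 a b)
      rw [hk']
      rfl⟩)

instance (X : Type u) [TopologicalSpace X] : DecidableEq (PointedCover X) := Classical.decEq _

/-- `Ext¹(A, B) = H¹(X, ℋom(A, B)) = H¹(X, A* ⊗ B)` for holomorphic vector bundles: Čech
cohomology, the colimit over all covers. -/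
def Ext1 (A : HolBundle.{u, v} X) (B : HolBundle.{u, w} X) : Type (max u v w) :=
  Module.DirectLimit (R := ℂ) (H1 A B) (fun _ _ h => H1.res A B h)

instance (A : HolBundle.{u, v} X) (B : HolBundle.{u, w} X) : AddCommGroup (Ext1 A B) :=
  inferInstanceAs (AddCommGroup
    (Module.DirectLimit (R := ℂ) (H1 A B) (fun _ _ h => H1.res A B h)))

instance (A : HolBundle.{u, v} X) (B : HolBundle.{u, w} X) : Module ℂ (Ext1 A B) :=
  inferInstanceAs (Module ℂ (Module.DirectLimit (R := ℂ) (H1 A B) (fun _ _ h => H1.res A B h)))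

/-- The class of a cocycle. -/
def Ext1.mk {A : HolBundle.{u, v} X} {B : HolBundle.{u, w} X} (U : PointedCover X) :
    Z1 A B U →ₗ[ℂ] Ext1 A B :=
  (Module.DirectLimit.of ℂ (PointedCover X) (H1 A B) (fun _ _ h => H1.res A B h) U) ∘ₗ
    H1.mk A B U

section Map

variable {A : HolBundle.{u, v} X} {B : HolBundle.{u, w} X}
    {A' : HolBundle.{u, w₁} X} {B' : HolBundle.{u, w₂} X} (T : HomMap A B A' B')

/-- The map on cocycles. -/
def Z1.map (U : PointedCover X) : Z1 A B U →ₗ[ℂ] Z1 A' B' U where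
  toFun c := ⟨fun a b => T.onSections _ (c.1 a b), fun a b d x ha hb hd => by
    exact (congrArg (T.toFun x) (c.2 a b d x ha hb hd)).trans (map_add (T.toFun x) _ _)⟩
  map_add' _ _ := by
    ext1; funext a b; exact map_add (T.onSections _) _ _
  map_smul' _ _ := by
    ext1; funext a b; exact map_smul (T.onSections _) _ _

/-- The map on the cohomology of a cover. -/
def H1.map (U : PointedCover X) : H1 A B U →ₗ[ℂ] H1 A' B' U :=
  Submodule.mapQ _ _ (Z1.map T U) (by
    rintro c ⟨k, hk⟩
    exact ⟨fun a => T.onSections _ (k a), by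
      funext a b
      have hk' : c.1 a b = d0 A B U k a b := (congrFun (congrFun hk a) b).symm
      change _ = T.onSections _ (c.1 a b)
      rw [hk']
      change _ = T.onSections _ (_ - _)
      rw [map_sub]
      rfl⟩)

/-- The map `Ext¹(A, B) → Ext¹(A', B')` induced by a map of sheaves `ℋom(A, B) → ℋom(A', B')`. -/
def Ext1.map : Ext1 A B →ₗ[ℂ] Ext1 A' B' :=
  Module.DirectLimit.map (H1.map T) (fun U V h => by
    refine LinearMap.ext fun c => ?_
    obtain ⟨c, rfl⟩ := Submodule.mkQ_surjective _ c
    rfl)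

theorem Ext1.map_mk (U : PointedCover X) (c : Z1 A B U) :
    Ext1.map T (Ext1.mk U c) = Ext1.mk U (Z1.map T U c) := by
  exact Module.DirectLimit.map_apply_of _ _ _

end Map

theorem Ext1.mk_res {A : HolBundle.{u, v} X} {B : HolBundle.{u, w} X} {U V : PointedCover X}
    (h : U ≤ V) (c : Z1 A B U) : Ext1.mk V (Z1.res A B h c) = Ext1.mk U c :=
  Module.DirectLimit.of_f (f := fun _ _ h => H1.res A B h) (hij := h) (x := H1.mk A B U c)

theorem Ext1.mk_eq_of_sub {A : HolBundle.{u, v} X} {B : HolBundle.{u, w} X} {U : PointedCover X}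
    {c c' : Z1 A B U} (k : C0 A B U) (h : d0 A B U k = c.1 - c'.1) :
    Ext1.mk U c = Ext1.mk U c' :=
  congrArg (Module.DirectLimit.of ℂ (PointedCover X) (H1 A B) (fun _ _ h => H1.res A B h) U)
    ((Submodule.Quotient.eq _).2 ⟨k, h⟩)

end Cech

noncomputable section Extensions

variable {X : Type u} [TopologicalSpace X] [ChartedSpace ℂ X]

/-- A short exact sequence `0 → A → E → B → 0` of holomorphic vector bundles. -/
structure Extension (A : HolBundle.{u, v} X) (E : HolBundle.{u, w} X) (B : HolBundle.{u, w₁} X) where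
  incl : Morphism A E
  proj : Morphism E B
  incl_injective : ∀ x, Function.Injective (incl x)
  proj_surjective : ∀ x, Function.Surjective (proj x)
  exact : ∀ x, range (incl x) = {e | proj x e = 0}

variable {A : HolBundle.{u, v} X} {E : HolBundle.{u, w} X} {B : HolBundle.{u, w₁} X}

/-- `δ` is the class in `Ext¹(B, A)` of the extension: it is represented by the cocycle
`c_{ab} = σ_b - σ_a : B → A` of the differences of some holomorphic splittings `σ_a : B → E` of
`E → B` over the members of a cover. -/
def Extension.IsClass (S : Extension A E B) (δ : Ext1 B A) : Prop :=
  ∃ (U : PointedCover X) (σ : C0 B E U) (c : Z1 B A U),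
    (∀ a x (hx : x ∈ U.nhd a), S.proj x ∘L (σ a).val x hx = ContinuousLinearMap.id ℂ _) ∧
    (∀ a b x (ha : x ∈ U.nhd a) (hb : x ∈ U.nhd b),
      S.incl x ∘L (c.1 a b).val x ⟨ha, hb⟩ = (σ b).val x hb - (σ a).val x ha) ∧
    Ext1.mk U c = δ

theorem Extension.exists_factor_sec (S : Extension A E B) {W : Set X} (d : Sec B E W)
    (hd : ∀ x hx, S.proj x ∘L d.val x hx = 0) :
    ∃ c : Sec B A W, ∀ x hx, S.incl x ∘L c.val x hx = d.val x hx := by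
  obtain ⟨ψ, hψ, e⟩ := d.2
  obtain ⟨c, hc, hcd⟩ := S.incl.exists_factor S.incl_injective hψ (fun x hx m => by
    rw [S.exact x, ← e ⟨x, hx⟩]
    exact DFunLike.congr_fun (hd x hx) m)
  exact ⟨⟨fun x => c x, c, hc, fun _ => rfl⟩, fun x hx => (hcd x hx).trans (e ⟨x, hx⟩).symm⟩

theorem Extension.incl_comp_injective (S : Extension A E B) {x : X}
    {f g : B.Fiber x →L[ℂ] A.Fiber x} (h : S.incl x ∘L f = S.incl x ∘L g) : f = g := by
  ext m
  exact S.incl_injective x (DFunLike.congr_fun h m)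

theorem Extension.exists_isClass (S : Extension A E B) : ∃ δ, S.IsClass δ := by
  choose W s hW hxW hs hps using S.proj.exists_local_section S.proj_surjective
  let U : PointedCover X := ⟨W, hW, hxW⟩
  let σ : C0 B E U := fun a => ⟨fun x => s a x, s a, hs a, fun _ => rfl⟩
  have hσ : ∀ a x (hx : x ∈ U.nhd a), S.proj x ∘L (σ a).val x hx = ContinuousLinearMap.id ℂ _ :=
    fun a x hx => hps a x hx
  have h : ∀ a b, ∃ c : Sec B A (U.nhd a ∩ U.nhd b), ∀ x hx,
      S.incl x ∘L c.val x hx = (σ b).val x hx.2 - (σ a).val x hx.1 := fun a b =>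
    S.exists_factor_sec (d0 B E U σ a b) fun x hx => by
      change S.proj x ∘L ((σ b).val x hx.2 - (σ a).val x hx.1) = 0
      rw [ContinuousLinearMap.comp_sub, hσ, hσ, sub_self]
  choose c hc using h
  refine ⟨_, U, σ, ⟨c, fun a b d x ha hb hd => ?_⟩, hσ, fun a b x ha hb => hc a b x ⟨ha, hb⟩, rfl⟩
  apply S.incl_comp_injective
  rw [ContinuousLinearMap.comp_add]
  refine (hc a d x ⟨ha, hd⟩).trans ?_
  refine Eq.trans ?_ (congrArg₂ (· + ·) (hc a b x ⟨ha, hb⟩) (hc b d x ⟨hb, hd⟩)).symm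
  exact (sub_add_sub_cancel' _ _ _).symm

theorem Extension.isClass_unique (S : Extension A E B) {δ δ' : Ext1 B A} (h : S.IsClass δ)
    (h' : S.IsClass δ') : δ = δ' := by
  obtain ⟨U, σ, c, hσ, hc, rfl⟩ := h
  obtain ⟨U', σ', c', hσ', hc', rfl⟩ := h'
  let V : PointedCover X := ⟨fun a => U.nhd a ∩ U'.nhd a, fun a => (U.isOpen a).inter (U'.isOpen a),
    fun a => ⟨U.mem a, U'.mem a⟩⟩
  have hU : U ≤ V := fun a => inter_subset_left
  have hU' : U' ≤ V := fun a => inter_subset_right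
  have h : ∀ a, ∃ k : Sec B A (V.nhd a), ∀ x hx,
      S.incl x ∘L k.val x hx = (σ a).val x hx.1 - (σ' a).val x hx.2 := fun a =>
    S.exists_factor_sec (Sec.res B E (hU a) (σ a) - Sec.res B E (hU' a) (σ' a)) fun x hx => by
      change S.proj x ∘L ((σ a).val x hx.1 - (σ' a).val x hx.2) = 0
      rw [ContinuousLinearMap.comp_sub, hσ, hσ', sub_self]
  choose k hk using h
  rw [← Ext1.mk_res hU, ← Ext1.mk_res hU']
  refine Ext1.mk_eq_of_sub k ?_
  funext a b
  ext1 x hx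
  apply S.incl_comp_injective
  change S.incl x ∘L ((k b).val x hx.2 - (k a).val x hx.1) =
    S.incl x ∘L ((c.1 a b).val x ⟨hx.1.1, hx.2.1⟩ - (c'.1 a b).val x ⟨hx.1.2, hx.2.2⟩)
  rw [ContinuousLinearMap.comp_sub, ContinuousLinearMap.comp_sub, hk, hk,
    hc a b x hx.1.1 hx.2.1, hc' a b x hx.1.2 hx.2.2]
  abel

/-- The class of an extension `0 → A → E → B → 0` in `Ext¹(B, A)`; it exists and does not depend on
the local splittings. -/
def Extension.cls (S : Extension A E B) : Ext1 B A := S.exists_isClass.choose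

theorem Extension.isClass_iff (S : Extension A E B) (δ : Ext1 B A) : S.IsClass δ ↔ δ = S.cls :=
  ⟨fun h => S.isClass_unique h S.exists_isClass.choose_spec,
    fun h => h ▸ S.exists_isClass.choose_spec⟩

end Extensions

noncomputable section Symplectic

variable {X : Type u} [TopologicalSpace X] [ChartedSpace ℂ X]

/-- A holomorphic symplectic form `Ω` on `A`, given by `Ω^♭ : A → A*`, `v ↦ Ω(v, ·)`. -/
structure SymplecticForm (A : HolBundle.{u, v} X) where
  flat : Morphism A A.dual
  alternating : ∀ x v, flat x v v = 0
  nondegenerate : ∀ x v, (∀ w, flat x v w = 0) → v = 0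

variable {A : HolBundle.{u, v} X} {B : HolBundle.{u, w} X} {C : HolBundle.{u, w₁} X}

theorem SymplecticForm.flat_isInvertible (Ω : SymplecticForm A) (x : X) :
    (Ω.flat x).IsInvertible := by
  apply isInvertible_of_bijective
  have hinj : Function.Injective (Ω.flat x) := by
    rw [injective_iff_map_eq_zero]
    exact fun v hv => Ω.nondegenerate x v fun w => DFunLike.congr_fun hv w
  refine ⟨hinj, ?_⟩
  have hd : Module.finrank ℂ (A.Fiber x) = Module.finrank ℂ (A.dual.Fiber x) := by
    rw [← Subspace.dual_finrank_eq (K := ℂ) (V := A.Fiber x)]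
    exact (LinearMap.toContinuousLinearMap (𝕜 := ℂ) (E := A.Fiber x) (F' := ℂ)).finrank_eq
  exact (LinearMap.injective_iff_surjective_of_finrank_eq_finrank hd
    (f := (Ω.flat x : A.Fiber x →ₗ[ℂ] A.dual.Fiber x))).1 hinj

/-- The inverse `(Ω^♭)⁻¹ : A* → A` of `Ω^♭`. -/
def SymplecticForm.sharp (Ω : SymplecticForm A) : Morphism A.dual A where
  toFun x := (Ω.flat x).inverse
  isHol := Ω.flat.isHol.inverse fun x _ => Ω.flat_isInvertible x

/-- The `θ`-dual `δ^θ ∈ Ext¹(B*, A)` of a class `δ ∈ Ext¹(A, B)`, obtained through the map of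
sheaves `ℋom(A, B) → ℋom(B*, A*) → ℋom(B*, A)`, `c ↦ (θ^♭)⁻¹ ∘ cᵗ`; in terms of tensor products it
is `(θ^♭)⁻¹ ⊗ id : A* ⊗ B → A ⊗ B`. -/
def SymplecticForm.dualClass (θ : SymplecticForm A) : Ext1 A B →ₗ[ℂ] Ext1 B.dual A :=
  Ext1.map (HomMap.postcomp B.dual θ.sharp) ∘ₗ Ext1.map (HomMap.transpose A B)

/-- The fibrewise characterisation of the `θ`-dual: `θ(c^θ(s), u) = ⟨c(u), s⟩`. -/
theorem SymplecticForm.sharp_transpose (θ : SymplecticForm A) (x : X)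
    (c : A.Fiber x →L[ℂ] B.Fiber x) (s : B.dual.Fiber x) (u : A.Fiber x) :
    θ.flat x (θ.sharp x ((HomMap.transpose A B).toFun x c s)) u = s (c u) := by
  change θ.flat x ((θ.flat x).inverse _) u = _
  rw [(θ.flat_isInvertible x).self_apply_inverse]
  rfl

end Symplectic

/-- `L` is a `K^{-1/2}`: a holomorphic line bundle with `L ⊗ L ≅ K⁻¹ = TX`. The isomorphism is
given by the bilinear map `q : L × L → TX`, which is non-zero on non-zero vectors. -/
def IsInvSqrtCanonical {X : Type u} [TopologicalSpace X] [ChartedSpace ℂ X] [IsManifold 𝓘(ℂ) ω X]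
    (L : HolBundle.{u, v} X) : Prop :=
  L.rank = 1 ∧ ∃ q : Morphism L (L.hom (tangent X)), ∀ x (l : L.Fiber x), l ≠ 0 → q x l l ≠ 0

end HolBundle

/-! Choose a cover with local splittings `σ_a : U → E` and `τ_a : L⁻¹ → V`, with difference cocycles
`c_{ab} : U → L` and `e_{ab} : L⁻¹ → E`; write `p : E → U` for the projection and suppress the
inclusions. A form satisfying the required conditions is prescribed on `E × E` (by `θ`) and on `L ×
V` (by `q`). Since `L⁻¹` has rank one, an alternating form vanishes on the image of `τ_a`. The only
freedom left is the mixed term `Ω(σ_a u, τ_a s)`, which nondegeneracy of `θ` allows to be written as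
`-θ(k_a s, u)` for a unique `k_a : L⁻¹ → U` (`IsCompatible.ext`), and locally every holomorphic
`k_a` occurs (`exists_isCompatible`).

Changing frames from `a` to `b` alters the mixed term by `⟨c_{ab} u, s⟩ - θ(p e_{ab} s, u)`
(`IsCompatible.mixed`). Hence local forms agree on overlaps exactly when `k_b - k_a = p ∘ e_{ab} -
c^θ_{ab}`, that is, when the cochain `k` is a primitive of the difference between the image of the
second cocycle and the `θ`-dual of the first (`d0_eq_sub_iff`). A global form therefore yields a
primitive (`exists_cochain_of_isCompatible`), and a primitive yields local forms that glue
(`exists_symplecticForm`).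

Nondegeneracy of `Ω` and `L^⊥ = E` impose no further constraint: both follow from the other
conditions fibre by fibre. -/

namespace HolBundle

variable {X : Type u} [TopologicalSpace X] [ChartedSpace ℂ X]

/-! ### Evaluation into the double dual -/

/-- Evaluation `A → A**` on the fibre at `x`. -/
noncomputable def evalDual (A : HolBundle.{u, v} X) (x : X) :
    A.Fiber x →L[ℂ] A.dual.dual.Fiber x :=
  LinearMap.toContinuousLinearMap
    { toFun := fun a => LinearMap.toContinuousLinearMap
        { toFun := fun s : A.dual.Fiber x => s a
          map_add' := fun _ _ => rfl
          map_smul' := fun _ _ => rfl }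
      map_add' := fun a b => ContinuousLinearMap.ext fun s => map_add s a b
      map_smul' := fun r a => ContinuousLinearMap.ext fun s => map_smul s r a }

theorem evalDual_apply (A : HolBundle.{u, v} X) (x : X) (a : A.Fiber x) (s : A.dual.Fiber x) :
    A.evalDual x a s = s a :=
  rfl

theorem isHolOn_evalDual (A : HolBundle.{u, v} X) (W : Set X) : IsHolOn W A.evalDual := by
  refine IsHolOn.of_coord fun x₀ hx₀ =>
    -- Evaluation commutes with changes of trivialisation, so its coordinate matrix is constant: the
    -- evaluation map of the model fibre, which is the flip of the identity on the dual.
    ⟨fun x => (ContinuousLinearMap.id ℂ (A.Model →L[ℂ] ℂ)).flip, contMDiffWithinAt_const, ?_⟩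
  intro x _ hA hA'
  ext m s
  obtain ⟨t, rfl⟩ := (A.dual.chart x₀ (A.dual.dual_triv hA')).surjective s
  simp only [ContinuousLinearMap.comp_apply, ContinuousLinearEquiv.coe_coe]
  rw [dual_chart_apply A.dual hA', ContinuousLinearMap.comp_apply, ContinuousLinearEquiv.coe_coe,
    ContinuousLinearEquiv.symm_apply_apply, evalDual_apply, dual_chart_apply]
  rfl

/-! ### Equality of classes in the colimit over covers -/

/-- Directedness, by index-wise intersection, gives common refinements and makes the vanishing of an
element of the colimit visible at a finite stage. -/
instance : IsDirectedOrder (PointedCover X) where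
  directed U V := ⟨⟨fun a => U.nhd a ∩ V.nhd a, fun a => (U.isOpen a).inter (V.isOpen a),
    fun a => ⟨U.mem a, V.mem a⟩⟩, fun _ => inter_subset_left, fun _ => inter_subset_right⟩

instance (A : HolBundle.{u, v} X) (B : HolBundle.{u, w} X) :
    DirectedSystem (H1 A B) (fun _ _ h => H1.res A B h) where
  map_self _ c := by
    obtain ⟨c, rfl⟩ := Submodule.mkQ_surjective _ c
    rfl
  map_map _ _ _ _ _ c := by
    obtain ⟨c, rfl⟩ := Submodule.mkQ_surjective _ c
    rfl

/-- Cocycles with the same class become cohomologous on a refinement. -/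
theorem Ext1.exists_of_mk_eq {A : HolBundle.{u, v} X} {B : HolBundle.{u, w} X}
    {U : PointedCover X} {c c' : Z1 A B U} (h : Ext1.mk U c = Ext1.mk U c') :
    ∃ (V : PointedCover X) (hV : U ≤ V) (k : C0 A B V),
      d0 A B V k = (Z1.res A B hV c).1 - (Z1.res A B hV c').1 := by
  -- The colimit criterion concerns classes that become zero, so it is applied to the difference.
  have h0 : Ext1.mk U (c - c') = 0 := by rw [map_sub, h, sub_self]
  obtain ⟨V, hV, h1⟩ := Module.DirectLimit.of.zero_exact h0
  obtain ⟨k, hk⟩ := (Submodule.Quotient.mk_eq_zero _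
    (x := Z1.res A B hV (c - c'))).1 h1
  exact ⟨V, hV, k, hk⟩

/-! ### Local splittings and retractions of an extension -/

variable {A : HolBundle.{u, v} X} {E : HolBundle.{u, w} X} {B : HolBundle.{u, w₁} X}

/-- `σ` is a family of splittings of `S` over `U`, and `c` is its cocycle of differences. -/
structure Extension.IsSplitting (S : Extension A E B) {U : PointedCover X} (σ : C0 B E U)
    (c : Z1 B A U) : Prop where
  proj_comp : ∀ a x (hx : x ∈ U.nhd a) b, S.proj x ((σ a).val x hx b) = b
  incl_comp : ∀ a b x (ha : x ∈ U.nhd a) (hb : x ∈ U.nhd b) m,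
    S.incl x ((c.1 a b).val x ⟨ha, hb⟩ m) = (σ b).val x hb m - (σ a).val x ha m

theorem Extension.IsSplitting.res {S : Extension A E B} {U V : PointedCover X} {σ : C0 B E U}
    {c : Z1 B A U} (h : S.IsSplitting σ c) (hV : U ≤ V) :
    S.IsSplitting (fun a => Sec.res B E (hV a) (σ a)) (Z1.res B A hV c) :=
  ⟨fun a x hx => h.proj_comp a x (hV a hx),
    fun a b x ha hb => h.incl_comp a b x (hV a ha) (hV b hb)⟩

theorem Extension.exists_isSplitting (S : Extension A E B) :
    ∃ (U : PointedCover X) (σ : C0 B E U) (c : Z1 B A U),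
      S.IsSplitting σ c ∧ Ext1.mk U c = S.cls := by
  obtain ⟨U, σ, c, h, h', h''⟩ := (S.isClass_iff _).2 rfl
  exact ⟨U, σ, c, ⟨fun a x hx => DFunLike.congr_fun (h a x hx),
    fun a b x ha hb => DFunLike.congr_fun (h' a b x ha hb)⟩, h''⟩

theorem Extension.proj_incl (S : Extension A E B) (x : X) (l : A.Fiber x) :
    S.proj x (S.incl x l) = 0 :=
  (S.exact x).subset ⟨l, rfl⟩

theorem Extension.exists_incl_eq (S : Extension A E B) {x : X} {e : E.Fiber x}
    (he : S.proj x e = 0) : ∃ l, S.incl x l = e :=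
  (S.exact x).superset he

/-- The retraction onto `A` belonging to a local splitting. -/
theorem Extension.exists_retraction (S : Extension A E B) {W : Set X}
    {σ : ∀ x, B.Fiber x →L[ℂ] E.Fiber x} (hσ : IsHolOn W σ)
    (h : ∀ x ∈ W, ∀ b, S.proj x (σ x b) = b) :
    ∃ r : ∀ x, E.Fiber x →L[ℂ] A.Fiber x, IsHolOn W r ∧
      ∀ x ∈ W, ∀ e, S.incl x (r x e) = e - σ x (S.proj x e) := by
  obtain ⟨r, hr, h'⟩ := S.incl.exists_factor S.incl_injective
    -- The projector `id - σ ∘ proj` takes values in the kernel of `proj`, so it factors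
    -- holomorphically through `A`.
    (d := fun x => ContinuousLinearMap.id ℂ _ + (-1 : ℂ) • (σ x ∘L S.proj x))
    ((isHolOn_id W).add ((hσ.comp (S.proj.isHol.mono (subset_univ _))).smul _))
    (fun x hx m => by
      rw [S.exact x]
      simp [h x hx])
  refine ⟨r, hr, fun x hx e => (DFunLike.congr_fun (h' x hx) e).trans ?_⟩
  simp [sub_eq_add_neg]

/-! ### Fibrewise algebra of symplectic and compatible forms -/

theorem SymplecticForm.flat_neg (Ω : SymplecticForm A) (x : X) (a b : A.Fiber x) :
    -Ω.flat x a b = Ω.flat x b a := by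
  have := Ω.alternating x (a + b)
  simp only [map_add, _root_.add_apply, Ω.alternating, zero_add, add_zero] at this
  linear_combination -this

theorem SymplecticForm.flat_sharp (θ : SymplecticForm A) (x : X) (f : A.dual.Fiber x) :
    θ.flat x (θ.sharp x f) = f :=
  (θ.flat_isInvertible x).self_apply_inverse _

section Compatible

variable {L : HolBundle.{u, v} X} {U : HolBundle.{u, w} X} {E : HolBundle.{u, w₁} X}
  {V : HolBundle.{u, w₂} X}

/-- The form `Ω` on the fibre of `V` at `x` is alternating, induces `θ` on `E / L ≅ U` and the
given identification `V / E ≅ L⁻¹`. -/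
structure IsCompatible (θ : SymplecticForm U) (S : Extension L E U) (T : Extension E V L.dual)
    (x : X) (Ω : V.Fiber x →L[ℂ] V.dual.Fiber x) : Prop where
  alternating : ∀ v, Ω v v = 0
  apply_incl_incl : ∀ e e', Ω (T.incl x e) (T.incl x e') = θ.flat x (S.proj x e) (S.proj x e')
  apply_incl_incl_left : ∀ l v, Ω (T.incl x (S.incl x l)) v = T.proj x v l

variable {θ : SymplecticForm U} {S : Extension L E U} {T : Extension E V L.dual} {x : X}
  {Ω Ω' : V.Fiber x →L[ℂ] V.dual.Fiber x}

theorem IsCompatible.neg (h : IsCompatible θ S T x Ω) (v v' : V.Fiber x) : -Ω v v' = Ω v' v := by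
  have := h.alternating (v + v')
  simp only [map_add, _root_.add_apply, h.alternating, zero_add, add_zero] at this
  linear_combination -this

/-- A vector of the radical is pushed down the filtration `L ⊆ E ⊆ V`: pairing with `L` puts it in
`E`, pairing with `E` and nondegeneracy of `θ` put it in `L`, and pairing with `V` kills it because
`V → L⁻¹` is surjective and functionals separate the points of `L`. -/
theorem IsCompatible.nondegenerate (h : IsCompatible θ S T x Ω) {v : V.Fiber x}
    (hv : ∀ v', Ω v v' = 0) : v = 0 := by
  have hq : T.proj x v = 0 := by
    ext l
    rw [← h.apply_incl_incl_left, ← h.neg, hv, neg_zero]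
    rfl
  obtain ⟨e, rfl⟩ := T.exists_incl_eq hq
  have hp : S.proj x e = 0 := θ.nondegenerate x _ fun u => by
    obtain ⟨e', rfl⟩ := S.proj_surjective x u
    rw [← h.apply_incl_incl, hv]
  obtain ⟨l, rfl⟩ := S.exists_incl_eq hp
  have hl : l = 0 := by
    refine (Module.forall_dual_apply_eq_zero_iff ℂ l).1 fun s => ?_
    obtain ⟨v', hv'⟩ := T.proj_surjective x (LinearMap.toContinuousLinearMap s)
    have := h.apply_incl_incl_left l v'
    rw [hv, hv'] at this
    exact this.symm
  rw [hl, map_zero, map_zero]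

theorem IsCompatible.orthogonal (h : IsCompatible θ S T x Ω) :
    {v | ∀ l, Ω (T.incl x (S.incl x l)) v = 0} = range (T.incl x) := by
  rw [T.exact x]
  ext v
  simp only [mem_ofPred_eq, h.apply_incl_incl_left]
  exact ⟨fun h => ContinuousLinearMap.ext h, fun h l => by rw [h]; rfl⟩

/-- The change of the mixed term of a compatible form under a change of splittings. -/
theorem IsCompatible.mixed (h : IsCompatible θ S T x Ω) {σ σ' : U.Fiber x →L[ℂ] E.Fiber x}
    {τ τ' : L.dual.Fiber x →L[ℂ] V.Fiber x} {c : U.Fiber x →L[ℂ] L.Fiber x}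
    {e : L.dual.Fiber x →L[ℂ] E.Fiber x} (hτ : ∀ s, T.proj x (τ s) = s)
    (hσ' : ∀ u, S.proj x (σ' u) = u)
    (hc : ∀ u, S.incl x (c u) = σ' u - σ u) (he : ∀ s, T.incl x (e s) = τ' s - τ s)
    (u : U.Fiber x) (s : L.dual.Fiber x) :
    Ω (T.incl x (σ' u)) (τ' s) =
      Ω (T.incl x (σ u)) (τ s) + s (c u) - θ.flat x (S.proj x (e s)) u := by
  -- The difference of the two mixed terms is `Ω(σ' u, e s) + Ω(c u, τ s)`. The first summand lies
  -- in `E × E` and the second in `L × V`, so compatibility evaluates both.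
  have h1 := h.apply_incl_incl (σ' u) (e s)
  have h2 := h.apply_incl_incl_left (c u) (τ s)
  rw [he, hσ', map_sub, ← θ.flat_neg] at h1
  rw [hc, hτ, map_sub, map_sub, _root_.sub_apply] at h2
  linear_combination h1 + h2

theorem finrank_fiber (A : HolBundle.{u, v} X) (x : X) :
    Module.finrank ℂ (A.Fiber x) = A.rank :=
  (A.chart x (mem_of_mem_nhds (A.triv_mem x))).toLinearEquiv.finrank_eq

theorem exists_smul_eq_dual (hL : L.rank = 1) (x : X) :
    ∃ s₀ : L.dual.Fiber x, ∀ s, ∃ r : ℂ, r • s₀ = s := by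
  have h : Module.finrank ℂ (L.dual.Fiber x) = 1 := by
    rw [← hL, ← finrank_fiber L x, ← Subspace.dual_finrank_eq (K := ℂ) (V := L.Fiber x)]
    exact (LinearMap.toContinuousLinearMap (𝕜 := ℂ) (E := L.Fiber x) (F' := ℂ)).finrank_eq.symm
  obtain ⟨s₀, -, h⟩ := finrank_eq_one_iff'.1 h
  exact ⟨s₀, h⟩

/-- A compatible form is determined by its mixed term. -/
theorem IsCompatible.ext (hL : L.rank = 1) (h : IsCompatible θ S T x Ω)
    (h' : IsCompatible θ S T x Ω')
    {σ : U.Fiber x →L[ℂ] E.Fiber x} {τ : L.dual.Fiber x →L[ℂ] V.Fiber x}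
    (hτ : ∀ s, T.proj x (τ s) = s) (hσ : ∀ u, S.proj x (σ u) = u)
    (hm : ∀ u s, Ω (T.incl x (σ u)) (τ s) = Ω' (T.incl x (σ u)) (τ s)) : Ω = Ω' := by
  -- Modulo `L`, where the pairing is prescribed, `e` equals `σ (proj e)`.
  have h1 : ∀ e s, Ω (T.incl x e) (τ s) = Ω' (T.incl x e) (τ s) := by
    intro e s
    obtain ⟨l, hl⟩ := S.exists_incl_eq (e := e - σ (S.proj x e))
      (by rw [map_sub, hσ, sub_self])
    rw [eq_sub_iff_add_eq] at hl
    rw [← hl]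
    simp only [map_add, _root_.add_apply]
    rw [h.apply_incl_incl_left, h'.apply_incl_incl_left, hm]
  -- Here rank one enters: `s` and `s'` are multiples of one `s₀`, so both sides vanish because the
  -- forms are alternating.
  have h2 : ∀ s s', Ω (τ s) (τ s') = Ω' (τ s) (τ s') := by
    obtain ⟨s₀, hs₀⟩ := exists_smul_eq_dual hL x
    intro s s'
    obtain ⟨r, rfl⟩ := hs₀ s
    obtain ⟨r', rfl⟩ := hs₀ s'
    simp only [map_smul, _root_.smul_apply, h.alternating, h'.alternating]
  have hV : ∀ v, ∃ e s, v = T.incl x e + τ s := by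
    intro v
    obtain ⟨e, he⟩ := T.exists_incl_eq (e := v - τ (T.proj x v)) (by rw [map_sub, hτ, sub_self])
    exact ⟨e, _, by rw [he, sub_add_cancel]⟩
  ext v v'
  obtain ⟨e, s, rfl⟩ := hV v
  obtain ⟨e', s', rfl⟩ := hV v'
  simp only [map_add, _root_.add_apply]
  rw [h.apply_incl_incl, h'.apply_incl_incl, h1, h2, ← h.neg (T.incl x e') (τ s),
    ← h'.neg (T.incl x e') (τ s), h1]

/-! ### From mixed terms to forms and back -/

/-- Local existence of a compatible form with prescribed mixed term. -/
theorem exists_isCompatible (θ : SymplecticForm U) (S : Extension L E U)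
    (T : Extension E V L.dual) {W : Set X}
    {σ : ∀ x, U.Fiber x →L[ℂ] E.Fiber x} {τ : ∀ x, L.dual.Fiber x →L[ℂ] V.Fiber x}
    {k : ∀ x, L.dual.Fiber x →L[ℂ] U.Fiber x}
    (hσ : IsHolOn W σ) (hτ : IsHolOn W τ) (hk : IsHolOn W k)
    (hpσ : ∀ x ∈ W, ∀ u, S.proj x (σ x u) = u) (hqτ : ∀ x ∈ W, ∀ s, T.proj x (τ x s) = s) :
    ∃ Ω : ∀ x, V.Fiber x →L[ℂ] V.dual.Fiber x, IsHolOn (A := V) (B := V.dual) W Ω ∧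
      ∀ x ∈ W, IsCompatible θ S T x (Ω x) ∧
        ∀ u s, Ω x (T.incl x (σ x u)) (τ x s) = -θ.flat x (k x s) u := by
  have hW := subset_univ W
  -- The corrected splitting `τ - σ ∘ k` is the one on which the form being built has zero mixed
  -- term. Its retraction `r : V → E`, together with `l : E → L` coming from `σ`, decomposes `V`
  -- locally as `L ⊕ U ⊕ L⁻¹`.
  obtain ⟨r, hr, hjr⟩ := T.exists_retraction
    (σ := fun x => τ x + (-1 : ℂ) • (T.incl x ∘L (σ x ∘L k x)))
    (hτ.add (((T.incl.isHol.mono hW).comp (hσ.comp hk)).smul _)) (fun x hx s => by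
      simp only [_root_.add_apply, _root_.smul_apply, map_add, map_smul,
        ContinuousLinearMap.comp_apply, hqτ x hx, T.proj_incl]
      exact (congrArg _ (smul_zero _)).trans (add_zero _))
  obtain ⟨l, hl, hil⟩ := S.exists_retraction hσ hpσ
  have hμ : IsHolOn W (fun x => S.proj x ∘L r x) := (S.proj.isHol.mono hW).comp hr
  have hρ : IsHolOn W (fun x => l x ∘L r x) := hl.comp hr
  have hq := T.proj.isHol.mono hW
  -- The standard form of this decomposition: `θ` on `U` plus the antisymmetrised natural pairing of
  -- `L` with `L⁻¹`. Each summand is a composite of holomorphic maps, their transposes and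
  -- evaluation.
  refine ⟨_, ((hμ.transpose.comp ((θ.flat.isHol.mono hW).comp hμ)).add
    (hq.transpose.comp ((isHolOn_evalDual L W).comp hρ))).add
      ((hρ.transpose.comp hq).smul (-1 : ℂ)), fun x hx => ?_⟩
  have hform : ∀ v v', (((ContinuousLinearMap.precomp ℂ (S.proj x ∘L r x)) ∘L
      (θ.flat x ∘L (S.proj x ∘L r x)) + (ContinuousLinearMap.precomp ℂ (T.proj x)) ∘L
      (L.evalDual x ∘L (l x ∘L r x)) +
      (-1 : ℂ) • (ContinuousLinearMap.precomp ℂ (l x ∘L r x)) ∘L (T.proj x) :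
        V.Fiber x →L[ℂ] V.dual.Fiber x)) v v' =
      θ.flat x (S.proj x (r x v)) (S.proj x (r x v')) + T.proj x v' (l x (r x v)) -
        T.proj x v (l x (r x v')) := by
    intro v v'
    simp [sub_eq_add_neg]
    rfl
  have hre : ∀ e, r x (T.incl x e) = e := fun e => T.incl_injective x (by
    rw [hjr x hx, T.proj_incl, map_zero, sub_zero])
  have hli : ∀ m, l x (S.incl x m) = m := fun m => S.incl_injective x (by
    rw [hil x hx, S.proj_incl, map_zero, sub_zero])
  have hlσ : ∀ u, l x (σ x u) = 0 := fun u => S.incl_injective x (by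
    rw [hil x hx, hpσ x hx, map_zero, sub_self])
  -- Because `r` kills the corrected splitting, the original `τ` retains the component `σ ∘ k`; this
  -- is what produces the mixed term `-θ(k s, u)`.
  have hrτ : ∀ s, r x (τ x s) = σ x (k x s) := fun s => T.incl_injective x (by
    rw [hjr x hx, hqτ x hx]
    simp)
  refine ⟨⟨fun v => ?_, fun e e' => ?_, fun m v => ?_⟩, fun u s => ?_⟩
  · rw [hform, θ.alternating]; ring
  · rw [hform, hre, hre, T.proj_incl, T.proj_incl]; simp
  · rw [hform, hre, S.proj_incl, hli, T.proj_incl]; simp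
  · rw [hform, hre, hlσ, hrτ, hpσ x hx, hpσ x hx, hlσ, θ.flat_neg]; simp

/-- Local compatible forms with the mixed terms `-θ(k_a(s), u)` glue to a symplectic form on `V`. -/
theorem exists_symplecticForm (hL : L.rank = 1) {W : PointedCover X} {σ : C0 U E W}
    {c : Z1 U L W} {τ : C0 L.dual V W} {e : Z1 L.dual E W} (hS : S.IsSplitting σ c)
    (hT : T.IsSplitting τ e) (k : C0 L.dual U W)
    (hk : ∀ a b x (ha : x ∈ W.nhd a) (hb : x ∈ W.nhd b) s u,
      θ.flat x ((k b).val x hb s - (k a).val x ha s) u =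
        θ.flat x (S.proj x ((e.1 a b).val x ⟨ha, hb⟩ s)) u - s ((c.1 a b).val x ⟨ha, hb⟩ u)) :
    ∃ Ω : SymplecticForm V, ∀ x, IsCompatible θ S T x (Ω.flat x) := by
  choose σ' hσ' hσe using fun a => (σ a).2
  choose τ' hτ' hτe using fun a => (τ a).2
  choose k' hk' hke using fun a => (k a).2
  have hloc : ∀ a, ∃ Ω : ∀ x, V.Fiber x →L[ℂ] V.dual.Fiber x,
      IsHolOn (A := V) (B := V.dual) (W.nhd a) Ω ∧
      ∀ x (hx : x ∈ W.nhd a), IsCompatible θ S T x (Ω x) ∧ ∀ u s,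
        Ω x (T.incl x ((σ a).val x hx u)) ((τ a).val x hx s) =
          -θ.flat x ((k a).val x hx s) u := by
    intro a
    obtain ⟨Ω, h, h'⟩ := exists_isCompatible θ S T (hσ' a) (hτ' a) (hk' a)
      (fun x hx => hσe a ⟨x, hx⟩ ▸ hS.proj_comp a x hx)
      (fun x hx => hτe a ⟨x, hx⟩ ▸ hT.proj_comp a x hx)
    exact ⟨Ω, h, fun x hx => ⟨(h' x hx).1, fun u s => by
      have := (h' x hx).2 u s
      rwa [← hσe a ⟨x, hx⟩, ← hτe a ⟨x, hx⟩, ← hke a ⟨x, hx⟩] at this⟩⟩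
  choose Ω hΩ hΩc using hloc
  have hglue : ∀ a b x, x ∈ W.nhd a → x ∈ W.nhd b → Ω a x = Ω b x := by
    intro a b x ha hb
    -- Both forms are compared in the frame `b`; the mixed term of `Ω a`, known in the frame `a`, is
    -- transported there, and the relation on `k` is precisely the required equality.
    refine (hΩc a x ha).1.ext hL (hΩc b x hb).1 (hT.proj_comp b x hb) (hS.proj_comp b x hb)
      fun u s => ?_
    have h1 := (hΩc a x ha).1.mixed (hT.proj_comp a x ha) (hS.proj_comp b x hb)
      (hS.incl_comp a b x ha hb) (hT.incl_comp a b x ha hb) u s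
    have h2 := hk a b x ha hb s u
    rw [(hΩc a x ha).2] at h1
    rw [map_sub, _root_.sub_apply] at h2
    rw [h1, (hΩc b x hb).2]
    linear_combination h2
  have hcomp : ∀ x, IsCompatible θ S T x (Ω x x) := fun x => (hΩc x x (W.mem x)).1
  -- At each point the local form indexed by that point is used; near `a` it coincides with the
  -- holomorphic `Ω a`.
  refine ⟨⟨⟨fun x => Ω x x, IsHolOn.of_local fun a _ => ⟨W.nhd a, W.isOpen a, W.mem a, ?_⟩⟩,
    fun x => (hcomp x).alternating, fun x _ => (hcomp x).nondegenerate⟩, hcomp⟩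
  exact ((hΩ a).mono inter_subset_right).congr fun x hx => hglue x a x (W.mem x) hx.2

/-- The mixed terms of a global compatible form bound the difference of the two classes. -/
theorem exists_cochain_of_isCompatible {Ω : SymplecticForm V}
    (h : ∀ x, IsCompatible θ S T x (Ω.flat x)) {W : PointedCover X} {σ : C0 U E W}
    {c : Z1 U L W} {τ : C0 L.dual V W} {e : Z1 L.dual E W} (hS : S.IsSplitting σ c)
    (hT : T.IsSplitting τ e) :
    ∃ k : C0 L.dual U W, ∀ a b x (ha : x ∈ W.nhd a) (hb : x ∈ W.nhd b) s u,
      θ.flat x ((k b).val x hb s - (k a).val x ha s) u =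
        θ.flat x (S.proj x ((e.1 a b).val x ⟨ha, hb⟩ s)) u - s ((c.1 a b).val x ⟨ha, hb⟩ u) := by
  have hloc : ∀ a, ∃ k : Sec L.dual U (W.nhd a), ∀ x (hx : x ∈ W.nhd a) s u,
      θ.flat x (k.val x hx s) u =
        -Ω.flat x (T.incl x ((σ a).val x hx u)) ((τ a).val x hx s) := by
    intro a
    obtain ⟨σ', hσ', hσe⟩ := (σ a).2
    obtain ⟨τ', hτ', hτe⟩ := (τ a).2
    have hW := subset_univ (W.nhd a)
    -- The section is `s ↦ (θ^♭)⁻¹(Ω(τ s, σ ·))`, so `θ(k s, u) = Ω(τ s, σ u) = -Ω(σ u, τ s)`; the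
    -- holomorphy proof fixes the omitted terms.
    refine ⟨⟨fun x => _, _, (θ.sharp.isHol.mono hW).comp
      (((T.incl.isHol.mono hW).comp hσ').transpose.comp ((Ω.flat.isHol.mono hW).comp hτ')),
      fun _ => rfl⟩, fun x hx s u => ?_⟩
    have h1 : (σ a).val x hx = σ' x := hσe ⟨x, hx⟩
    have h2 : (τ a).val x hx = τ' x := hτe ⟨x, hx⟩
    rw [h1, h2, Ω.flat_neg]
    exact DFunLike.congr_fun (θ.flat_sharp x _) u
  choose k hk using hloc
  refine ⟨k, fun a b x ha hb s u => ?_⟩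
  have h1 := (h x).mixed (hT.proj_comp a x ha) (hS.proj_comp b x hb)
      (hS.incl_comp a b x ha hb) (hT.incl_comp a b x ha hb) u s
  rw [map_sub, _root_.sub_apply, hk, hk]
  linear_combination -h1

/-- The primitives of the difference of the image of `e` and the `θ`-dual of `c`. -/
theorem d0_eq_sub_iff (θ : SymplecticForm U) (S : Extension L E U) {W : PointedCover X}
    (c : Z1 U L W) (e : Z1 L.dual E W) (k : C0 L.dual U W) :
    d0 L.dual U W k = (Z1.map (HomMap.postcomp L.dual S.proj) W e).1 -
        (Z1.map (HomMap.postcomp L.dual θ.sharp) W (Z1.map (HomMap.transpose U L) W c)).1 ↔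
      ∀ a b x (ha : x ∈ W.nhd a) (hb : x ∈ W.nhd b) s u,
        θ.flat x ((k b).val x hb s - (k a).val x ha s) u =
          θ.flat x (S.proj x ((e.1 a b).val x ⟨ha, hb⟩ s)) u -
            s ((c.1 a b).val x ⟨ha, hb⟩ u) := by
  have key : ∀ a b x (hx : x ∈ W.nhd a ∩ W.nhd b) s u,
      θ.flat x ((((Z1.map (HomMap.postcomp L.dual S.proj) W e).1 -
        (Z1.map (HomMap.postcomp L.dual θ.sharp) W
          (Z1.map (HomMap.transpose U L) W c)).1) a b).val x hx s) u =
      θ.flat x (S.proj x ((e.1 a b).val x hx s)) u - s ((c.1 a b).val x hx u) := by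
    intro a b x hx s u
    rw [← θ.sharp_transpose, ← _root_.sub_apply, ← map_sub]
    rfl
  constructor
  · intro h a b x ha hb s u
    refine Eq.trans ?_ (key a b x ⟨ha, hb⟩ s u)
    rw [← h]
    rfl
  · intro h
    funext a b
    ext x hx s
    rw [← sub_eq_zero]
    -- No information is lost by testing an equation in `U` against `θ(·, u)` for all `u`.
    refine θ.nondegenerate x _ fun u => ?_
    rw [map_sub, _root_.sub_apply, key, sub_eq_zero, ← h a b x hx.1 hx.2]
    rfl

end Compatible

end HolBundle

/-! ### The equivalence -/

theorem mainTheorem7 {X : Type u} [TopologicalSpace X] [T2Space X] [CompactSpace X]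
    [ConnectedSpace X] [ChartedSpace ℂ X] [IsManifold 𝓘(ℂ) ω X]
    (n : ℕ) (hn : 1 ≤ n)
    (L : HolBundle.{u, v} X) (U : HolBundle.{u, w} X) (E : HolBundle.{u, w₁} X)
    (V : HolBundle.{u, w₂} X)
    (hL : L.IsInvSqrtCanonical)
    (hU : U.rank = 2 * n - 2) (θ : HolBundle.SymplecticForm U)
    (S : HolBundle.Extension L E U) (T : HolBundle.Extension E V L.dual) :
    (∃ Ω : HolBundle.SymplecticForm V,
      -- the orthogonal complement of `L` is `E`
      (∀ x, {v | ∀ l, Ω.flat x (T.incl x (S.incl x l)) v = 0} = range (T.incl x)) ∧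
      -- the form induced on `E / L ≅ U` is `θ`
      (∀ x e e', Ω.flat x (T.incl x e) (T.incl x e') = θ.flat x (S.proj x e) (S.proj x e')) ∧
      -- the identification of `V / E` with `L⁻¹` induced by `Ω` is the given one
      (∀ x l v, Ω.flat x (T.incl x (S.incl x l)) v = T.proj x v l)) ↔
    HolBundle.Ext1.map (HolBundle.HomMap.postcomp L.dual S.proj) T.cls =
      θ.dualClass S.cls := by
  obtain ⟨P, σ, c, hσ, hc⟩ := S.exists_isSplitting
  obtain ⟨Q, τ, e, hτ, he⟩ := T.exists_isSplitting
  -- The two extensions come with splittings over different covers; a common refinement carries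
  -- both.
  obtain ⟨W, hPW, hQW⟩ := exists_ge_ge P Q
  replace hσ := hσ.res hPW
  replace hτ := hτ.res hQW
  rw [← HolBundle.Ext1.mk_res hPW] at hc
  rw [← HolBundle.Ext1.mk_res hQW] at he
  rw [← hc, ← he, HolBundle.SymplecticForm.dualClass, LinearMap.comp_apply,
    HolBundle.Ext1.map_mk, HolBundle.Ext1.map_mk, HolBundle.Ext1.map_mk]
  constructor
  · rintro ⟨Ω, -, h2, h3⟩
    obtain ⟨k, hk⟩ := HolBundle.exists_cochain_of_isCompatible
      (fun x => ⟨Ω.alternating x, h2 x, h3 x⟩) hσ hτ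
    exact HolBundle.Ext1.mk_eq_of_sub k ((HolBundle.d0_eq_sub_iff θ S _ _ k).2 hk)
  · intro h
    -- Equality of classes in the colimit supplies a primitive only over a finer cover, to which the
    -- splittings are restricted again.
    obtain ⟨W', hW', k, hk⟩ := HolBundle.Ext1.exists_of_mk_eq h
    obtain ⟨Ω, hΩ⟩ := HolBundle.exists_symplecticForm hL.1 (hσ.res hW') (hτ.res hW') k
      ((HolBundle.d0_eq_sub_iff θ S _ _ k).1 hk)
    exact ⟨Ω, fun x => (hΩ x).orthogonal, fun x => (hΩ x).apply_incl_incl,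
      fun x => (hΩ x).apply_incl_incl_left⟩
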